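/- For $\mathbf a,\mathbf t\in\mathbb R^3$ let $\rho(\mathbf a,\mathrm{diag}\,\mathbf t)=\frac14\big(I\otimes I+\mathbf a\cdot\boldsymbol\sigma\otimes I+\sum_{i=1}^3 t_i\,\sigma_i\otimes\sigma_i\big)$, an operator on Alice's and Bob's qubits. A two-qubit state $\rho$ is called non-steerable (by projective measurements of Alice) if there are a probability space $(L,\mu)$ and a measurable family of qubit states $(\sigma_\lambda)_{\lambda\in L}$ such that for every projective measurement $\{\Pi_k\}_k$ on Alice's qubit there are measurable response functions $p_k\ge 0$ on $L$ with $\sum_k p_k=1$ and $\mathrm{Tr}_A[(\Pi_k\otimes I)\rho]=\int p_k(\lambda)\,\sigma_\lambda\,d\mu(\lambda)$ for all $k$. Let $0\le a<1$ and write $(t_1',t_2',t_3')=(r\sin\alpha\cos\beta,\ r\sin\alpha\sin\beta,\ r\cos\alpha)$ with $r\ge 0$, $\alpha\in[0,\pi]$ and $\beta\in[0,2\pi]$, $\cos\beta=\sin\beta$, so that $t_1'=t_2'$. Put $c=\frac{2\cot^2\alpha}{1-a}-1$ and $$ r(\alpha)=\frac{\sqrt{2(1-a)}}{\sin\alpha}\cdot\begin{cases}\Big[\sqrt{1+c}+\frac1{\sqrt{-c}}\arcsin\sqrt{-c}\Big]^{-1},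 & c<0,\\[4pt] \Big[\sqrt{1+c}+\frac{1}{2\sqrt c}\ln\frac{\sqrt{1+c}+\sqrt c}{\sqrt{1+c}-\sqrt c}\Big]^{-1}, & c>0,\end{cases}$$ extended by continuity, i.e. with the bracket $[\,\cdot\,]$ equal to $2$ at $c=0$, and $r(0)=r(\pi)=1-a$. (1) The surface $r=r(\alpha)$ consists of the images of the solutions of the T-state border equation under the extremal maps with $u=v$: one has $r=r(\alpha)$ if and only if there are $u\in[0,\pi)$ and $T=\mathrm{diag}(t_1,t_2,t_3)$ with $\frac1{2\pi}\iint\sqrt{\hat x^{\top}T^2\hat x}\;d^2\hat x=1$ (integral over the unit sphere) such that $(\Phi_{u,u}\otimes \mathrm{id})\,\rho(\mathbf 0,T)=\rho(a\hat e_z,\mathrm{diag}[t_1',t_2',t_3'])$. Here $\Phi_{u,v}$ is the linear map with $\Phi_{u,v}(I)=I+\sin u\sin v\,\sigma_3$, $\Phi_{u,v}(\sigma_1)=\cos u\,\sigma_1$, $\Phi_{u,v}(\sigma_2)=\cos v\,\sigma_2$, $\Phi_{u,v}(\sigma_3)=\cos u\cos v\,\sigma_3$. (2) If $r\le r(\alpha)$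 and $\rho(a\hat e_z,\mathrm{diag}[t_1',t_1',t_3'])$ is a state, then it is non-steerable. (3) For $a=1/10$ the states in (2) include, in the octant $t_i'\le 0$, an entangled state that violates the criterion $\max_{|\hat x|=1}\big[(\mathbf a\cdot\hat x)^2+2\|T'\hat x\|\big]\le 1$ of Bowles et al. -/

import Mathlib

open scoped Kronecker ComplexOrder

noncomputable section

namespace Steering

/-- Operators on one qubit. -/
abbrev Op := Matrix (Fin 2) (Fin 2) ℂ

/-- Operators on two qubits; the first index belongs to Alice, the second to Bob. -/
abbrev Op2 := Matrix (Fin 2 × Fin 2) (Fin 2 × Fin 2) ℂ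

/-- The identity `σ₀` followed by the Pauli matrices `σ₁, σ₂, σ₃`. -/
def pauli : Fin 4 → Op :=
  ![1, !![0, 1; 1, 0], !![0, -Complex.I; Complex.I, 0], !![1, 0; 0, -1]]

/-- Density operators: positive semidefinite with trace one. -/
def IsState {n : Type} [Fintype n] (ρ : Matrix n n ℂ) : Prop :=
  ρ.PosSemidef ∧ ρ.trace = 1

/-- The operator `¼ (I ⊗ I + a·σ ⊗ I + ∑ᵢ tᵢ σᵢ ⊗ σᵢ)` denoted by `(a, diag t)`. -/
def canonicalState (a t : Fin 3 → ℝ) : Op2 :=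
  (1 / 4 : ℂ) • ((1 : Op) ⊗ₖ (1 : Op)
    + ∑ i, (a i : ℂ) • (pauli i.succ ⊗ₖ (1 : Op))
    + ∑ i, (t i : ℂ) • (pauli i.succ ⊗ₖ pauli i.succ))

/-- Partial trace over Alice's qubit. -/
def traceA (X : Op2) : Op := fun j j' => ∑ i, X (i, j) (i, j')

/-- Projective measurements on a qubit with outcomes in `Fin n`. -/
def IsProjectiveMeasurement {n : ℕ} (P : Fin n → Op) : Prop :=
  (∀ k, (P k).IsHermitian ∧ P k * P k = P k) ∧ ∑ k, P k = 1

/-- Alice cannot steer Bob by projective measurements: a single ensemble of local hidden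
states of Bob reproduces, with suitable response functions, the unnormalised conditional
states `Tr_A[(P k ⊗ I) ρ]` of every projective measurement of Alice. -/
def NonSteerable (ρ : Op2) : Prop :=
  ∃ (L : Type) (_ : MeasurableSpace L) (μ : MeasureTheory.Measure L) (σ : L → Op),
    MeasureTheory.IsProbabilityMeasure μ ∧
    (∀ i j, Measurable fun l => σ l i j) ∧
    (∀ l, IsState (σ l)) ∧
    ∀ (n : ℕ) (P : Fin n → Op), IsProjectiveMeasurement P →
      ∃ p : Fin n → L → ℝ,
        (∀ k, Measurable (p k)) ∧ (∀ k l, 0 ≤ p k l) ∧ (∀ l, ∑ k, p k l = 1) ∧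
        ∀ k i j, traceA ((P k ⊗ₖ (1 : Op)) * ρ) i j = ∫ l, (p k l : ℂ) * σ l i j ∂μ

/-- Separable operators: convex combinations of product states. -/
def IsSeparable (ρ : Op2) : Prop :=
  ρ ∈ convexHull ℝ {τ : Op2 | ∃ ρA ρB : Op, IsState ρA ∧ IsState ρB ∧ τ = ρA ⊗ₖ ρB}

/-- The criterion of Bowles et al. for `(a, diag t)`:
`max_x [(a·x)² + 2‖T x‖] ≤ 1` over unit vectors `x`. -/
def BowlesCriterion (a t : Fin 3 → ℝ) : Prop :=
  ∀ x : Fin 3 → ℝ, ∑ i, x i ^ 2 = 1 →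
    (∑ i, a i * x i) ^ 2 + 2 * √(∑ i, (t i * x i) ^ 2) ≤ 1

/-- The vector with spherical coordinates `r, α, β` (`α` is the polar angle). -/
def sph (r α β : ℝ) : Fin 3 → ℝ :=
  ![r * Real.sin α * Real.cos β, r * Real.sin α * Real.sin β, r * Real.cos α]

/-- The border equation of T-states, `(1/2π) ∬ √(xᵀ T² x) d²x = 1` for `T = diag t`, with
the surface integral over the unit sphere written in spherical coordinates. -/
def IsBorderT (t : Fin 3 → ℝ) : Prop :=
  (1 / (2 * Real.pi)) *
    (∫ φ in (0 : ℝ)..(2 * Real.pi), ∫ θ in (0 : ℝ)..Real.pi,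
      √(∑ i, t i ^ 2 * sph 1 θ φ i ^ 2) * Real.sin θ) = 1

/-- The matrix, in the basis `σ₀, …, σ₃`, of the extremal qubit channel with parameters
`u, v`. -/
def extremalMatrix (u v : ℝ) : Matrix (Fin 4) (Fin 4) ℝ :=
  !![1, 0, 0, 0;
     0, Real.cos u, 0, 0;
     0, 0, Real.cos v, 0;
     Real.sin u * Real.sin v, 0, 0, Real.cos u * Real.cos v]

/-- The qubit map with `Φ(σ_ν) = ∑_μ M_{μν} σ_μ`; the coefficient of `σ_ν` in `X` is
`Tr(σ_ν X) / 2`. -/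
def pauliMap (M : Matrix (Fin 4) (Fin 4) ℝ) (X : Op) : Op :=
  ∑ μ, ∑ ν, ((M μ ν : ℂ) * ((pauli ν * X).trace / 2)) • pauli μ

/-- `(Φ ⊗ id) ρ`: the map `Φ` applied to Alice's qubit. -/
def applyAlice (Φ : Op → Op) (ρ : Op2) : Op2 :=
  fun x y => Φ (fun i i' => ρ (i, x.2) (i', y.2)) x.1 y.1

/-- The bracket of the closed formula, with its limit `2` at `c = 0`. -/
def bracket (c : ℝ) : ℝ :=
  if c < 0 then √(1 + c) + 1 / √(-c) * Real.arcsin √(-c)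
  else if c = 0 then 2
  else √(1 + c) + 1 / (2 * √c) * Real.log ((√(1 + c) + √c) / (√(1 + c) - √c))

/-- The radius of the surface in the direction of polar angle `α`, with its limit `1 - a`
on the polar axis. -/
def surfaceRadius (a α : ℝ) : ℝ :=
  if Real.sin α = 0 then 1 - a
  else √(2 * (1 - a)) / Real.sin α *
    (bracket (2 * Real.cot α ^ 2 / (1 - a) - 1))⁻¹

end Steering

end

namespace Steering

/-! With `u = v`, the extremal map sends (0, diag t) to Alice's Bloch vector sin² u along z and
correlations (cos u · t₀, cos u · t₁, cos² u · t₂). Hence sin² u = a, and the preimage of a point is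
fixed up to the sign of cos u, which the border equation does not see because it contains only
squares. For t₀² = t₁² the border integral reduces to `sphereMean`, an elementary integral of √(1 +
c x²) evaluated by `bracket`. It is homogeneous of degree one, so at the preimage of `sph r α β` it
equals r divided by the radius of the surface (`sphereMean_preimage`); this gives (1).

For (2), measuring a projection on the image of the channel amounts to measuring its dual effect on
the T-state T = diag (p, p, q). The hidden variable y is taken in the unit ball with density
proportional to ‖T y‖, plus a correction when the mean is below 1, and Bob's Bloch vector is T y
divided by that unnormalised density. Alice's response is a constant plus a multiple of the sign of
y · m, with m the Bloch direction of the dual effect. By parity the constant reproduces the identity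
component and the sign the Pauli components, through the half-ball moment
`integral_ball_sign_inner`. Responses are nonnegative because the dual effect is a positive operator
(`norm_dualVec_le`).

For (3), an explicit point with c = -1/2 makes the bracket elementary in π. The swap operator
witnesses its entanglement. -/

/-! ### Pauli coordinates and the extremal channel -/

theorem canonicalState_eq (a t : Fin 3 → ℝ) (x y : Fin 2 × Fin 2) :
    canonicalState a t x y = (1 / 4 : ℂ) * ((1 : Op) x.1 y.1 * (1 : Op) x.2 y.2
      + ∑ i, (a i : ℂ) * (pauli i.succ x.1 y.1 * (1 : Op) x.2 y.2)
      + ∑ i, (t i : ℂ) * (pauli i.succ x.1 y.1 * pauli i.succ x.2 y.2)) := by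
  simp only [canonicalState, Matrix.smul_apply, Matrix.add_apply, Matrix.sum_apply,
    Matrix.kroneckerMap_apply, smul_eq_mul]

theorem pauliMap_extremalMatrix (u v : ℝ) (X : Op) :
    pauliMap (extremalMatrix u v) X =
      !![(X 0 0 + X 1 1) / 2 * (1 + Real.sin u * Real.sin v)
            + (X 0 0 - X 1 1) / 2 * (Real.cos u * Real.cos v),
          (X 0 1 + X 1 0) / 2 * Real.cos u + (X 0 1 - X 1 0) / 2 * Real.cos v;
         (X 0 1 + X 1 0) / 2 * Real.cos u - (X 0 1 - X 1 0) / 2 * Real.cos v,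
          (X 0 0 + X 1 1) / 2 * (1 - Real.sin u * Real.sin v)
            - (X 0 0 - X 1 1) / 2 * (Real.cos u * Real.cos v)] := by
  ext i j
  fin_cases i <;> fin_cases j <;>
    simp [pauliMap, extremalMatrix, pauli, Fin.sum_univ_succ, Matrix.trace, Matrix.mul_apply,
      Matrix.vecHead, Matrix.vecTail] <;>
    ring_nf <;> simp only [Complex.I_sq] <;> ring

theorem applyAlice_extremalMatrix (u v : ℝ) (t : Fin 3 → ℝ) :
    applyAlice (pauliMap (extremalMatrix u v)) (canonicalState 0 t)
      = canonicalState ![0, 0, Real.sin u * Real.sin v]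
          ![Real.cos u * t 0, Real.cos v * t 1, Real.cos u * Real.cos v * t 2] := by
  ext ⟨i, j⟩ ⟨i', j'⟩
  refine (congrFun (congrFun (pauliMap_extremalMatrix u v
    (fun i i' => canonicalState 0 t (i, j) (i', j'))) i) i').trans ?_
  fin_cases i <;> fin_cases i' <;> fin_cases j <;> fin_cases j' <;>
    simp [canonicalState_eq, pauli, Fin.sum_univ_succ] <;> ring

theorem canonicalState_inj {a t a' t' : Fin 3 → ℝ}
    (h : canonicalState a t = canonicalState a' t') : a 2 = a' 2 ∧ t = t' := by
  have e : ∀ x y, canonicalState a t x y = canonicalState a' t' x y := fun x y => by rw [h]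
  have h0 := congrArg Complex.re (e (0, 0) (0, 0))
  have h1 := congrArg Complex.re (e (1, 1) (1, 1))
  have h2 := congrArg Complex.re (e (0, 0) (1, 1))
  have h3 := congrArg Complex.re (e (0, 1) (1, 0))
  simp [canonicalState_eq, pauli, Fin.sum_univ_succ] at h0 h1 h2 h3
  refine ⟨by linarith, ?_⟩
  ext i
  fin_cases i <;> simp <;> linarith

/-! ### Entanglement witness and positivity -/

/-- The sum is Tr(ρ · SWAP), linear in ρ. On A ⊗ B it equals Tr(A B), and with A = C†C this is Tr(C
B C†) ≥ 0. -/
theorem swap_trace_nonneg_of_isSeparable {ρ : Op2} (h : IsSeparable ρ) :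
    0 ≤ (∑ i, ∑ j, ρ (i, j) (j, i)).re := by
  have hconv : Convex ℝ {ρ : Op2 | 0 ≤ (∑ i, ∑ j, ρ (i, j) (j, i)).re} := by
    intro x hx y hy s t hs ht _
    simp only [Set.mem_ofPred_eq, Fin.sum_univ_two, Matrix.add_apply, Matrix.smul_apply,
      Complex.add_re, Complex.real_smul, Complex.re_ofReal_mul] at hx hy ⊢
    linarith [mul_nonneg hs hx, mul_nonneg ht hy]
  refine convexHull_min ?_ hconv h
  rintro τ ⟨A, B, ⟨hA, _⟩, ⟨hB, _⟩, rfl⟩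
  obtain ⟨C, rfl⟩ : ∃ C : Op, A = C.conjTranspose * C := by
    open scoped MatrixOrder Matrix.Norms.L2Operator in
    obtain ⟨C, hC⟩ := CStarAlgebra.nonneg_iff_eq_star_mul_self.1 hA.nonneg
    exact ⟨C, hC⟩
  have h1 : (∑ i, ∑ j, ((C.conjTranspose * C) ⊗ₖ B) (i, j) (j, i))
      = (C * B * C.conjTranspose).trace := by
    rw [Matrix.trace_mul_comm, ← Matrix.mul_assoc, Matrix.trace]
    simp [Matrix.mul_apply]
  rw [Set.mem_ofPred_eq, h1]
  have := (hB.mul_mul_conjTranspose_same C).trace_nonneg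
  exact (Complex.le_def.1 this).1

/-- When t₀ = t₁ = s the only coherence lies between |01⟩ and |10⟩. For s ≤ 0 it is carried by a
multiple of the singlet projector, leaving a diagonal matrix. -/
theorem isState_canonicalState {a s q : ℝ} (hq : |a| ≤ 1 + q) (hs : |2 * s| + |a| ≤ 1 - q)
    (hs0 : s ≤ 0) : IsState (canonicalState ![0, 0, a] ![s, s, q]) := by
  have ha := abs_le.1 (le_refl |a|)
  rw [abs_of_nonpos (by linarith)] at hs
  constructor
  · have h : canonicalState ![0, 0, a] ![s, s, q]
        = Matrix.diagonal (fun x : Fin 2 × Fin 2 =>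
            (((!![1 + a + q, 1 + a - q + 2 * s; 1 - a - q + 2 * s, 1 - a + q] :
              Matrix (Fin 2) (Fin 2) ℝ) x.1 x.2 / 4 : ℝ) : ℂ))
          + ((-2 * s / 4 : ℝ) : ℂ) • Matrix.vecMulVec
              (fun x : Fin 2 × Fin 2 => (!![0, 1; -1, 0] : Op) x.1 x.2)
              (star fun x : Fin 2 × Fin 2 => (!![0, 1; -1, 0] : Op) x.1 x.2) := by
      ext ⟨i, j⟩ ⟨i', j'⟩
      fin_cases i <;> fin_cases i' <;> fin_cases j <;> fin_cases j' <;>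
        simp [canonicalState_eq, pauli, Fin.sum_univ_succ, Matrix.vecMulVec_apply] <;> ring_nf
    rw [h]
    refine (Matrix.PosSemidef.diagonal ?_).add
      ((Matrix.posSemidef_vecMulVec_self_star _).smul ?_)
    · rintro ⟨i, j⟩
      rw [Pi.zero_apply, Complex.zero_le_real]
      fin_cases i <;> fin_cases j <;> simp <;> linarith
    · rw [Complex.zero_le_real]
      linarith
  · rw [Matrix.trace, Fintype.sum_prod_type]
    simp [canonicalState_eq, pauli, Fin.sum_univ_succ]
    ring

/-! ### The border integral in closed form -/

/-- Twice the mean over the unit sphere of the norm of `diag (p, p, q) x`. -/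
noncomputable def sphereMean (p q : ℝ) : ℝ :=
  ∫ θ in (0 : ℝ)..Real.pi, √(p ^ 2 * Real.sin θ ^ 2 + q ^ 2 * Real.cos θ ^ 2) * Real.sin θ

theorem sphereMean_eq (p q : ℝ) :
    sphereMean p q = ∫ x in (-1 : ℝ)..1, √(p ^ 2 * (1 - x ^ 2) + q ^ 2 * x ^ 2) := by
  have h := intervalIntegral.integral_comp_mul_deriv (a := 0) (b := Real.pi)
    (f := Real.cos) (f' := fun x => -Real.sin x)
    (g := fun x => √(p ^ 2 * (1 - x ^ 2) + q ^ 2 * x ^ 2))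
    (fun x _ => Real.hasDerivAt_cos x) (by fun_prop) (by fun_prop)
  rw [Real.cos_zero, Real.cos_pi] at h
  rw [← neg_inj, ← intervalIntegral.integral_symm, ← h, sphereMean, ← intervalIntegral.integral_neg]
  congr 1
  ext θ
  simp [Real.sin_sq]

/-- Differentiability is asked only in the open interval: at c = -1 the arcsine primitive is not
covered by the derivative formulas at ±1. -/
theorem integral_sqrt_of_hasDerivAt {c : ℝ} {F : ℝ → ℝ} (hF : Continuous F)
    (hd : ∀ x ∈ Set.Ioo (-1 : ℝ) 1, HasDerivAt F (√(1 + c * x ^ 2)) x) :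
    ∫ x in (-1 : ℝ)..1, √(1 + c * x ^ 2) = F 1 - F (-1) :=
  intervalIntegral.integral_eq_sub_of_hasDerivAt_of_le (by norm_num) hF.continuousOn hd
    (Continuous.intervalIntegrable (by fun_prop) _ _)

/-- In this form, the reciprocal square root cancels against the derivative of the rescaled arcsin
(c < 0) or arsinh (c > 0), leaving twice the integrand of `integral_sqrt_eq_bracket`. -/
theorem hasDerivAt_mul_sqrt {c x : ℝ} (h : 0 < 1 + c * x ^ 2) :
    HasDerivAt (fun x => x * √(1 + c * x ^ 2))
      (2 * √(1 + c * x ^ 2) - 1 / √(1 + c * x ^ 2)) x := by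
  have h1 : HasDerivAt (fun x => 1 + c * x ^ 2) (c * (2 * x)) x := by
    simpa using ((hasDerivAt_pow 2 x).const_mul c).const_add 1
  refine ((hasDerivAt_id x).mul (h1.sqrt h.ne')).congr_deriv ?_
  have h2 : √(1 + c * x ^ 2) ≠ 0 := (Real.sqrt_pos.2 h).ne'
  have h3 := Real.sq_sqrt h.le
  simp only [id]
  field_simp
  linear_combination (-1) * h3

theorem integral_sqrt_eq_bracket {c : ℝ} (hc : -1 ≤ c) :
    ∫ x in (-1 : ℝ)..1, √(1 + c * x ^ 2) = bracket c := by
  rcases lt_trichotomy c 0 with h | h | h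
  · have hs : 0 < √(-c) := Real.sqrt_pos.2 (by linarith)
    have hsq : √(-c) ^ 2 = -c := Real.sq_sqrt (by linarith)
    rw [integral_sqrt_of_hasDerivAt
      (F := fun x => (x * √(1 + c * x ^ 2) + 1 / √(-c) * Real.arcsin (√(-c) * x)) / 2)
      (by fun_prop)]
    · simp only [bracket, if_pos h]
      simp [Real.arcsin_neg]
      ring
    · intro x hx
      have hx2 : x ^ 2 < 1 := by nlinarith [hx.1, hx.2]
      have hpos : 0 < 1 + c * x ^ 2 := by nlinarith
      have hlt : (√(-c) * x) ^ 2 < 1 := by rw [mul_pow, hsq]; linarith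
      have hlt' := abs_lt.1 ((sq_lt_one_iff_abs_lt_one _).1 hlt)
      have h2 := (Real.hasDerivAt_arcsin hlt'.1.ne' hlt'.2.ne).comp x
        ((hasDerivAt_id x).const_mul √(-c))
      refine (((hasDerivAt_mul_sqrt hpos).add
        (h2.const_mul (1 / √(-c)))).div_const 2).congr_deriv ?_
      rw [mul_pow, hsq]
      have : √(1 + c * x ^ 2) ≠ 0 := (Real.sqrt_pos.2 hpos).ne'
      rw [show 1 - -c * x ^ 2 = 1 + c * x ^ 2 by ring]
      field_simp
      ring
  · subst h
    norm_num [bracket]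
  · have hs : 0 < √c := Real.sqrt_pos.2 h
    have hsq : √c ^ 2 = c := Real.sq_sqrt h.le
    -- The numerator and denominator are conjugates with product 1, so the quotient is the square of
    -- the numerator, whose logarithm is arsinh √c.
    have hlog : Real.log ((√(1 + c) + √c) / (√(1 + c) - √c)) = 2 * Real.arsinh √c := by
      have h1 : √(1 + c) ^ 2 = 1 + c := Real.sq_sqrt (by linarith)
      have hlt : √c < √(1 + c) := Real.sqrt_lt_sqrt h.le (by linarith)
      have h2 : (√(1 + c) + √c) / (√(1 + c) - √c) = (√c + √(1 + c)) ^ 2 := by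
        rw [div_eq_iff (by linarith)]
        linear_combination (√c + √(1 + c)) * (hsq - h1)
      rw [Real.arsinh, hsq, h2, Real.log_pow, Nat.cast_ofNat]
    rw [integral_sqrt_of_hasDerivAt
      (F := fun x => (x * √(1 + c * x ^ 2) + 1 / √c * Real.arsinh (√c * x)) / 2)
      (by have := Real.continuous_arsinh; fun_prop)]
    · simp only [bracket, if_neg h.not_gt, if_neg h.ne', hlog]
      simp [Real.arsinh_neg]
      ring
    · intro x hx
      have hpos : 0 < 1 + c * x ^ 2 := by positivity
      have h2 := (Real.hasDerivAt_arsinh (√c * x)).comp x ((hasDerivAt_id x).const_mul √c)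
      refine (((hasDerivAt_mul_sqrt hpos).add
        (h2.const_mul (1 / √c))).div_const 2).congr_deriv ?_
      rw [mul_pow, hsq]
      have : √(1 + c * x ^ 2) ≠ 0 := (Real.sqrt_pos.2 hpos).ne'
      field_simp
      ring

theorem sphereMean_zero_left (q : ℝ) : sphereMean 0 q = |q| := by
  rw [sphereMean_eq]
  have h : ∀ x : ℝ, √((0 : ℝ) ^ 2 * (1 - x ^ 2) + q ^ 2 * x ^ 2) = |q| * |x| := fun x => by
    rw [← abs_mul, ← Real.sqrt_sq_eq_abs]
    congr 1
    ring
  simp_rw [h]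
  rw [intervalIntegral.integral_const_mul]
  have h1 : ∫ x in (-1 : ℝ)..1, |x| = 1 := by
    rw [← intervalIntegral.integral_add_adjacent_intervals (b := 0)
      (continuous_abs.intervalIntegrable _ _) (continuous_abs.intervalIntegrable _ _)]
    rw [intervalIntegral.integral_congr (g := fun x : ℝ => -x), 
      intervalIntegral.integral_congr (a := 0) (b := 1) (g := fun x : ℝ => x)]
    · rw [intervalIntegral.integral_neg, integral_id, integral_id]
      norm_num
    · intro x hx
      rw [Set.uIcc_of_le (by norm_num)] at hx
      exact abs_of_nonneg hx.1
    · intro x hx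
      rw [Set.uIcc_of_le (by norm_num)] at hx
      exact abs_of_nonpos hx.2
  rw [h1, mul_one]

theorem sphereMean_eq_bracket {p : ℝ} (hp : p ≠ 0) (q : ℝ) :
    sphereMean p q = |p| * bracket (q ^ 2 / p ^ 2 - 1) := by
  rw [← integral_sqrt_eq_bracket (by have : 0 ≤ q ^ 2 / p ^ 2 := by positivity
                                     linarith), sphereMean_eq,
    ← intervalIntegral.integral_const_mul]
  congr 1
  ext x
  rw [← Real.sqrt_sq_eq_abs, ← Real.sqrt_mul (sq_nonneg p)]
  congr 1
  field_simp
  ring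

theorem bracket_pos {c : ℝ} (hc : -1 ≤ c) : 0 < bracket c := by
  rw [← integral_sqrt_eq_bracket hc]
  refine intervalIntegral.intervalIntegral_pos_of_pos_on
    (Continuous.intervalIntegrable (by fun_prop) _ _) (fun x hx => Real.sqrt_pos.2 ?_) (by norm_num)
  have hx2 : x ^ 2 < 1 := by nlinarith [hx.1, hx.2]
  nlinarith [sq_nonneg x]

theorem isBorderT_iff {t : Fin 3 → ℝ} {p : ℝ} (h0 : t 0 ^ 2 = p ^ 2) (h1 : t 1 ^ 2 = p ^ 2) :
    IsBorderT t ↔ sphereMean p (t 2) = 1 := by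
  have h : ∀ φ θ : ℝ, √(∑ i, t i ^ 2 * sph 1 θ φ i ^ 2) * Real.sin θ
      = √(p ^ 2 * Real.sin θ ^ 2 + t 2 ^ 2 * Real.cos θ ^ 2) * Real.sin θ := fun φ θ => by
    congr 2
    simp only [Fin.sum_univ_three, h0, h1, sph, Matrix.cons_val]
    linear_combination p ^ 2 * Real.sin θ ^ 2 * Real.sin_sq_add_cos_sq φ
  simp only [IsBorderT, h]
  rw [intervalIntegral.integral_const, sub_zero, smul_eq_mul, ← mul_assoc,
    one_div_mul_cancel (by positivity), one_mul, sphereMean]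

/-- The mean for the preimage of `sph r α β` is `r` divided by the radius of the surface. -/
theorem sphereMean_preimage {a α r : ℝ} (ha : a < 1) (hα : α ∈ Set.Icc 0 Real.pi) (hr : 0 ≤ r) :
    sphereMean (r * Real.sin α / √(2 * (1 - a))) (r * Real.cos α / (1 - a))
      = r / surfaceRadius a α := by
  have ha' : 0 < 1 - a := by linarith
  rcases hr.eq_or_lt with rfl | hr
  · simp [sphereMean_zero_left]
  have hsin : 0 ≤ Real.sin α := Real.sin_nonneg_of_mem_Icc hα
  rcases hsin.eq_or_lt with hs | hs
  · rw [← hs, surfaceRadius, if_pos hs.symm, mul_zero, zero_div, sphereMean_zero_left, abs_div,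
      abs_mul, abs_of_pos hr, abs_of_pos ha']
    have : |Real.cos α| = 1 := by
      rw [← sq_eq_sq₀ (abs_nonneg _) zero_le_one, sq_abs, Real.cos_sq', ← hs]; norm_num
    rw [this, mul_one]
  · have hq : 0 < √(2 * (1 - a)) := Real.sqrt_pos.2 (by linarith)
    have hq2 : √(2 * (1 - a)) ^ 2 = 2 * (1 - a) := Real.sq_sqrt (by linarith)
    rw [sphereMean_eq_bracket (by positivity), surfaceRadius, if_neg hs.ne',
      abs_of_pos (by positivity)]
    have : (r * Real.cos α / (1 - a)) ^ 2 / (r * Real.sin α / √(2 * (1 - a))) ^ 2 - 1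
        = 2 * Real.cot α ^ 2 / (1 - a) - 1 := by
      rw [Real.cot_eq_cos_div_sin, div_pow _ √(2 * (1 - a)), hq2]
      field_simp
    rw [this]
    have hb : 0 < bracket (2 * Real.cot α ^ 2 / (1 - a) - 1) := bracket_pos (by
      have : 0 ≤ 2 * Real.cot α ^ 2 / (1 - a) := by positivity
      linarith)
    field_simp

theorem surfaceRadius_pos {a α : ℝ} (ha : a < 1) (hα : α ∈ Set.Icc 0 Real.pi) :
    0 < surfaceRadius a α := by
  have ha' : 0 < 1 - a := by linarith
  rw [surfaceRadius]
  split_ifs with h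
  · exact ha'
  · have hs : 0 < Real.sin α := (Real.sin_nonneg_of_mem_Icc hα).lt_of_ne' h
    have hb : 0 < bracket (2 * Real.cot α ^ 2 / (1 - a) - 1) := bracket_pos (by
      have : 0 ≤ 2 * Real.cot α ^ 2 / (1 - a) := by positivity
      linarith)
    positivity

/-! ### Integrals over the unit ball -/

open MeasureTheory

/-- Euclidean space of dimension three. -/
abbrev Space := EuclideanSpace ℝ (Fin 3)

theorem measurable_realSign : Measurable Real.sign :=
  Measurable.ite measurableSet_Iio measurable_const
    (Measurable.ite measurableSet_Ioi measurable_const measurable_const)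

theorem integrable_indicator_of_subset_Icc {α : Type*} [TopologicalSpace α] [Preorder α]
    [CompactIccSpace α] [T2Space α] [MeasurableSpace α] [OpensMeasurableSpace α]
    [SecondCountableTopology α] {μ : Measure α} [IsFiniteMeasureOnCompacts μ] {a b : α} {s : Set α}
    (hs : MeasurableSet s) (hab : s ⊆ Set.Icc a b) {f : α → ℝ} (hf : Continuous f) :
    Integrable (s.indicator f) μ :=
  (integrable_indicator_iff hs).2
    ((hf.continuousOn.integrableOn_compact isCompact_Icc).mono_set hab)

theorem integral_polar_radial (f : ℝ → ℝ) :
    ∫ w : ℝ × ℝ, f (w.1 ^ 2 + w.2 ^ 2)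
      = 2 * Real.pi * ∫ ρ in Set.Ioi (0 : ℝ), ρ * f (ρ ^ 2) := by
  rw [← integral_comp_polarCoord_symm]
  have h : ∀ x : ℝ × ℝ, x.1 • f ((polarCoord.symm x).1 ^ 2 + (polarCoord.symm x).2 ^ 2)
      = (x.1 * f (x.1 ^ 2)) * 1 := fun x => by
    rw [polarCoord_symm_apply, mul_pow, mul_pow, ← mul_add, Real.cos_sq_add_sin_sq, mul_one,
      mul_one, smul_eq_mul]
  simp_rw [h]
  rw [polarCoord_target, Measure.volume_eq_prod,
    setIntegral_prod_mul (fun ρ : ℝ => ρ * f (ρ ^ 2)) (fun _ => (1 : ℝ)), mul_comm]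
  congr 1
  simp
  rw [max_eq_left (by positivity)]
  ring

/-- The half disc is the meridian section of the ball, with x.1 the height and x.2 the distance from
the axis. In polar coordinates the Jacobian, the weight x.2 and the norm give s³, whence the factor
1/4; the angle that remains is the polar angle of the sphere. -/
theorem integral_halfDisc (p q : ℝ) :
    ∫ x : ℝ × ℝ, {x : ℝ × ℝ | 0 < x.2 ∧ x.2 ^ 2 + x.1 ^ 2 < 1}.indicator
        (fun x => x.2 * √(p ^ 2 * x.2 ^ 2 + q ^ 2 * x.1 ^ 2)) x
      = sphereMean p q / 4 := by
  rw [← integral_comp_polarCoord_symm]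
  have h : Set.EqOn (fun x : ℝ × ℝ => x.1 •
      {x : ℝ × ℝ | 0 < x.2 ∧ x.2 ^ 2 + x.1 ^ 2 < 1}.indicator
        (fun x => x.2 * √(p ^ 2 * x.2 ^ 2 + q ^ 2 * x.1 ^ 2)) (polarCoord.symm x))
      (fun x => (Set.Iio (1 : ℝ)).indicator (fun s => s ^ 3) x.1
        * (Set.Ioo 0 Real.pi).indicator (fun θ =>
          √(p ^ 2 * Real.sin θ ^ 2 + q ^ 2 * Real.cos θ ^ 2) * Real.sin θ) x.2)
      polarCoord.target := by
    rintro ⟨s, θ⟩ ⟨hs, hθ⟩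
    simp only [Set.mem_Ioi, Set.mem_Ioo] at hs hθ
    have hsin : 0 < s * Real.sin θ ↔ 0 < θ ∧ θ < Real.pi := by
      rw [mul_pos_iff_of_pos_left hs]
      refine ⟨fun h => ⟨?_, hθ.2⟩, fun h => Real.sin_pos_of_pos_of_lt_pi h.1 h.2⟩
      by_contra hc
      exact h.not_ge (Real.sin_nonpos_of_nonpos_of_neg_pi_le (not_lt.1 hc) hθ.1.le)
    have hnorm : (s * Real.sin θ) ^ 2 + (s * Real.cos θ) ^ 2 < 1 ↔ s < 1 := by
      rw [mul_pow, mul_pow, ← mul_add, Real.sin_sq_add_cos_sq, mul_one,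
        sq_lt_one_iff₀ hs.le]
    simp only [polarCoord_symm_apply, Set.indicator_apply, Set.mem_ofPred_eq, hsin, hnorm,
      Set.mem_Iio, Set.mem_Ioo, smul_eq_mul]
    by_cases h1 : s < 1 <;> by_cases h2 : 0 < θ ∧ θ < Real.pi <;> simp only [h1, h2, and_self,
      and_true, and_false, if_true, if_false, mul_zero, zero_mul]
    have : p ^ 2 * (s * Real.sin θ) ^ 2 + q ^ 2 * (s * Real.cos θ) ^ 2
        = s ^ 2 * (p ^ 2 * Real.sin θ ^ 2 + q ^ 2 * Real.cos θ ^ 2) := by ring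
    rw [this, Real.sqrt_mul (sq_nonneg s), Real.sqrt_sq hs.le]
    ring
  rw [setIntegral_congr_fun polarCoord.open_target.measurableSet h, polarCoord_target,
    Measure.volume_eq_prod, setIntegral_prod_mul, setIntegral_indicator measurableSet_Iio,
    setIntegral_indicator measurableSet_Ioo, Set.Ioi_inter_Iio,
    Set.inter_eq_self_of_subset_right (Set.Ioo_subset_Ioo_left (by linarith [Real.pi_pos])),
    ← integral_Ioc_eq_integral_Ioo, ← integral_Ioc_eq_integral_Ioo,
    ← intervalIntegral.integral_of_le zero_le_one,
    ← intervalIntegral.integral_of_le Real.pi_pos.le, ← sphereMean, integral_pow]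
  ring

/-- The coordinates `(z, (x, y))` of Euclidean space. -/
noncomputable def cylinderEquiv : Space ≃ᵐ ℝ × (ℝ × ℝ) :=
  (MeasurableEquiv.toLp 2 (Fin 3 → ℝ)).symm.trans
    ((MeasurableEquiv.piFinSuccAbove (fun _ => ℝ) 2).trans
      (MeasurableEquiv.prodCongr (MeasurableEquiv.refl ℝ) MeasurableEquiv.finTwoArrow))

theorem measurePreserving_cylinderEquiv : MeasurePreserving cylinderEquiv :=
  (((MeasurePreserving.id volume).prod (volume_preserving_finTwoArrow ℝ)).comp
    (volume_preserving_piFinSuccAbove (fun _ : Fin 3 => ℝ) 2)).comp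
    (EuclideanSpace.volume_preserving_symm_measurableEquiv_toLp (Fin 3))

theorem integral_ball_sqrt (p q : ℝ) :
    ∫ y in Metric.ball (0 : Space) 1, √(p ^ 2 * (y 0 ^ 2 + y 1 ^ 2) + q ^ 2 * y 2 ^ 2)
      = Real.pi / 2 * sphereMean p q := by
  set B : Set (ℝ × (ℝ × ℝ)) := {x | x.2.1 ^ 2 + x.2.2 ^ 2 + x.1 ^ 2 < 1} with hB
  set g : ℝ × (ℝ × ℝ) → ℝ := B.indicator
    (fun x => √(p ^ 2 * (x.2.1 ^ 2 + x.2.2 ^ 2) + q ^ 2 * x.1 ^ 2)) with hg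
  have h1 : ∫ y in Metric.ball (0 : Space) 1, √(p ^ 2 * (y 0 ^ 2 + y 1 ^ 2) + q ^ 2 * y 2 ^ 2)
      = ∫ x, g x := by
    rw [← integral_indicator measurableSet_ball,
      ← measurePreserving_cylinderEquiv.integral_comp']
    congr 1
    ext y
    have : y ∈ Metric.ball (0 : Space) 1 ↔ cylinderEquiv y ∈ B := by
      rw [mem_ball_zero_iff, ← sq_lt_one_iff₀ (norm_nonneg _), EuclideanSpace.real_norm_sq_eq,
        Fin.sum_univ_three]
      rfl
    by_cases hy : y ∈ Metric.ball (0 : Space) 1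
    · rw [Set.indicator_of_mem hy, hg, Set.indicator_of_mem (this.1 hy)]
      rfl
    · rw [Set.indicator_of_notMem hy, hg, Set.indicator_of_notMem (mt this.2 hy)]
  have hBm : MeasurableSet B := by
    apply IsOpen.measurableSet
    exact isOpen_lt (by fun_prop) continuous_const
  have hgi : Integrable g (volume.prod volume) := by
    refine integrable_indicator_of_subset_Icc hBm (a := (-1, (-1, -1))) (b := (1, (1, 1))) ?_
      (by fun_prop)
    rintro ⟨z, x, y⟩ h
    simp only [hB, Set.mem_ofPred_eq] at h
    refine ⟨⟨?_, ?_, ?_⟩, ?_, ?_, ?_⟩ <;>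
      nlinarith [sq_nonneg x, sq_nonneg y, sq_nonneg z]
  have h2 : ∀ z : ℝ, ∫ w : ℝ × ℝ, g (z, w) = 2 * Real.pi * ∫ ρ : ℝ,
      {x : ℝ × ℝ | 0 < x.2 ∧ x.2 ^ 2 + x.1 ^ 2 < 1}.indicator
        (fun x => x.2 * √(p ^ 2 * x.2 ^ 2 + q ^ 2 * x.1 ^ 2)) (z, ρ) := fun z => by
    have := integral_polar_radial fun s => if s + z ^ 2 < 1 then √(p ^ 2 * s + q ^ 2 * z ^ 2) else 0
    simp only [hg, hB, Set.indicator_apply, Set.mem_ofPred_eq]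
    rw [this, ← integral_indicator measurableSet_Ioi]
    congr 2
    ext ρ
    by_cases h0 : 0 < ρ <;> simp [h0]
  have hhi : Integrable ({x : ℝ × ℝ | 0 < x.2 ∧ x.2 ^ 2 + x.1 ^ 2 < 1}.indicator
        (fun x => x.2 * √(p ^ 2 * x.2 ^ 2 + q ^ 2 * x.1 ^ 2))) (volume.prod volume) := by
    refine integrable_indicator_of_subset_Icc ?_ (a := (-1, -1)) (b := (1, 1)) ?_ (by fun_prop)
    · exact ((isOpen_lt continuous_const continuous_snd).inter
        (isOpen_lt (f := fun x : ℝ × ℝ => x.2 ^ 2 + x.1 ^ 2) (g := fun _ => 1) (by fun_prop)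
          continuous_const)).measurableSet
    · rintro ⟨z, x⟩ ⟨_, h⟩
      simp only at h
      refine ⟨⟨?_, ?_⟩, ?_, ?_⟩ <;> simp only <;> nlinarith [sq_nonneg x, sq_nonneg z]
  rw [h1, Measure.volume_eq_prod, integral_prod g hgi]
  simp_rw [h2]
  rw [integral_const_mul, ← integral_prod _ hhi, ← Measure.volume_eq_prod, integral_halfDisc]
  ring

theorem integral_ball_abs_coord : ∫ y in Metric.ball (0 : Space) 1, |y 2| = Real.pi / 2 := by
  have h := integral_ball_sqrt 0 1
  rw [sphereMean_zero_left, abs_one, mul_one] at h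
  rw [← h]
  congr 1
  ext y
  simp [Real.sqrt_sq_eq_abs]

theorem integral_ball_comp (R : Space ≃ₗᵢ[ℝ] Space) (f : Space → ℝ) :
    ∫ y in Metric.ball (0 : Space) 1, f (R y) = ∫ y in Metric.ball (0 : Space) 1, f y := by
  have h := R.measurePreserving.setIntegral_preimage_emb
    R.toHomeomorph.measurableEmbedding f (Metric.ball 0 1)
  rwa [LinearIsometryEquiv.preimage_ball, map_zero] at h

theorem integral_ball_odd {f : Space → ℝ} (hf : ∀ y, f (-y) = -f y) :
    ∫ y in Metric.ball (0 : Space) 1, f y = 0 := by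
  have h := integral_ball_comp (LinearIsometryEquiv.neg ℝ) f
  simp only [LinearIsometryEquiv.coe_neg, hf, integral_neg] at h
  linarith

theorem integral_ball_abs_inner {n : Space} (hn : ‖n‖ = 1) :
    ∫ y in Metric.ball (0 : Space) 1, |inner ℝ y n| = Real.pi / 2 := by
  set e : Space := EuclideanSpace.single 2 1 with he
  have hen : ‖n‖ = ‖e‖ := by rw [hn, he]; simp
  -- Two vectors of equal length are exchanged by the reflection in the hyperplane orthogonal to
  -- their difference.
  obtain ⟨R, hR⟩ : ∃ R : Space ≃ₗᵢ[ℝ] Space, R n = e := ⟨_, Submodule.reflection_sub hen⟩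
  have h := integral_ball_comp R fun y => |inner ℝ y e|
  have h2 : ∀ y : Space, inner ℝ (R y) e = inner ℝ y n := fun y => by
    rw [← hR]
    exact R.inner_map_map _ _
  simp only [h2] at h
  rw [h, ← integral_ball_abs_coord]
  congr 1
  ext y
  rw [he, EuclideanSpace.inner_single_right]
  simp

theorem integrableOn_ball_of_continuous {f : Space → ℝ} (hf : Continuous f) :
    IntegrableOn f (Metric.ball (0 : Space) 1) :=
  (hf.continuousOn.integrableOn_compact (isCompact_closedBall 0 1)).mono_set
    Metric.ball_subset_closedBall

theorem abs_realSign_le (x : ℝ) : |Real.sign x| ≤ 1 := by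
  rcases Real.sign_apply_eq x with h | h | h <;> simp [h]

theorem integrableOn_ball_sign_mul (m : Space) {f : Space → ℝ} (hf : Continuous f) :
    IntegrableOn (fun y => Real.sign (inner ℝ y m) * f y) (Metric.ball (0 : Space) 1) := by
  refine (integrableOn_ball_of_continuous hf).bdd_mul (c := 1) ?_ (.of_forall fun y => ?_)
  · exact (measurable_realSign.comp (by fun_prop)).aestronglyMeasurable
  · exact abs_realSign_le _

/-- The first moment of the half ball, in a form that makes sense for vectors of any length. -/
theorem integral_ball_sign_inner (m w : Space) :
    ‖m‖ * ∫ y in Metric.ball (0 : Space) 1, Real.sign (inner ℝ y m) * inner ℝ y w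
      = Real.pi / 2 * inner ℝ m w := by
  rcases eq_or_ne m 0 with rfl | hm
  · simp
  have hm' : 0 < ‖m‖ := norm_pos_iff.2 hm
  -- R is the half-turn about the line of m. It preserves the sign of y · m, and y + R y is twice
  -- the projection of y onto m; averaging over R therefore reduces the moment to the integral of |y
  -- · m|.
  set R := Submodule.reflection (ℝ ∙ m) with hR
  have hRm : R m = m :=
    Submodule.reflection_mem_subspace_eq_self (Submodule.mem_span_singleton_self m)
  have h1 : ∀ y, inner ℝ (R y) m = inner ℝ y m := fun y => by
    conv_lhs => rw [← hRm]
    exact R.inner_map_map _ _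
  have h2 : ∀ y, inner ℝ (R y) w + inner ℝ y w
      = 2 * (inner ℝ m w / ‖m‖ ^ 2) * inner ℝ y m := fun y => by
    rw [hR, Submodule.reflection_singleton_apply, inner_sub_left, ← Nat.cast_smul_eq_nsmul ℝ,
      real_inner_smul_left, real_inner_smul_left, real_inner_comm m y]
    simp only [Nat.cast_ofNat, RCLike.ofReal_real_eq_id, id]
    ring
  have h3 := integral_ball_comp R fun y => Real.sign (inner ℝ y m) * inner ℝ y w
  simp only [h1] at h3
  have h4 : ∫ y in Metric.ball (0 : Space) 1, (Real.sign (inner ℝ y m) * inner ℝ (R y) w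
        + Real.sign (inner ℝ y m) * inner ℝ y w)
      = 2 * (inner ℝ m w / ‖m‖ ^ 2) * (‖m‖ * (Real.pi / 2)) := by
    rw [← integral_ball_abs_inner (n := ‖m‖⁻¹ • m) (by
      rw [norm_smul, norm_inv, norm_norm, inv_mul_cancel₀ hm'.ne']), ← integral_const_mul,
      ← integral_const_mul]
    congr 1
    ext y
    rw [← mul_add, h2, inner_smul_right, abs_mul, abs_of_pos (inv_pos.2 hm'),
      mul_inv_cancel_left₀ hm'.ne']
    have : Real.sign (inner ℝ y m) * inner ℝ y m = |inner ℝ y m| := by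
      rcases lt_trichotomy (inner ℝ y m) 0 with h | h | h
      · rw [Real.sign_of_neg h, abs_of_neg h]; ring
      · simp [h]
      · rw [Real.sign_of_pos h, abs_of_pos h]; ring
    rw [← this]
    ring
  rw [integral_add (integrableOn_ball_sign_mul m (by fun_prop))
    (integrableOn_ball_sign_mul m (by fun_prop)), h3] at h4
  have h5 : ∫ y in Metric.ball (0 : Space) 1, Real.sign (inner ℝ y m) * inner ℝ y w
      = inner ℝ m w / ‖m‖ ^ 2 * (‖m‖ * (Real.pi / 2)) := by linarith
  rw [h5]
  field_simp

/-! ### Bloch vectors and projective measurements -/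

/-- The qubit operator `½ (I + x·σ)`. -/
noncomputable def blochOp (x : Fin 3 → ℝ) : Op :=
  !![(1 + x 2) / 2, (x 0 - x 1 * Complex.I) / 2; (x 0 + x 1 * Complex.I) / 2, (1 - x 2) / 2]

theorem isState_blochOp {x : Fin 3 → ℝ} (hx : x 0 ^ 2 + x 1 ^ 2 + x 2 ^ 2 ≤ 1) :
    IsState (blochOp x) := by
  constructor
  · refine Matrix.PosSemidef.of_dotProduct_mulVec_nonneg ?_ fun v => ?_
    · ext i j
      fin_cases i <;> fin_cases j <;> simp [blochOp, Complex.ext_iff]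
    · rw [Complex.nonneg_iff]
      simp [blochOp, Matrix.mulVec, dotProduct, Fin.sum_univ_two]
      generalize (v 0).re = a
      generalize (v 0).im = b
      generalize (v 1).re = c
      generalize (v 1).im = d
      constructor
      -- Cauchy–Schwarz for x and the Bloch vector of v, whose length is ‖v‖². The three squares
      -- supplied are those of Lagrange's identity.
      · have h : (x 0 * (2 * (a * c + b * d)) + x 1 * (2 * (a * d - b * c))
            + x 2 * (a ^ 2 + b ^ 2 - c ^ 2 - d ^ 2)) ^ 2 ≤ (a ^ 2 + b ^ 2 + c ^ 2 + d ^ 2) ^ 2 := by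
          nlinarith [mul_le_mul_of_nonneg_right hx (sq_nonneg (a ^ 2 + b ^ 2 + c ^ 2 + d ^ 2)),
            sq_nonneg (x 0 * (2 * (a * d - b * c)) - x 1 * (2 * (a * c + b * d))),
            sq_nonneg (x 0 * (a ^ 2 + b ^ 2 - c ^ 2 - d ^ 2) - x 2 * (2 * (a * c + b * d))),
            sq_nonneg (x 1 * (a ^ 2 + b ^ 2 - c ^ 2 - d ^ 2) - x 2 * (2 * (a * d - b * c)))]
        have := (abs_le_of_sq_le_sq' h (by positivity)).1
        linarith
      · ring
  · rw [Matrix.trace, Fin.sum_univ_two]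
    simp [blochOp]
    ring

/-- The Bloch vector `Tr (P σᵢ)` of a qubit operator. -/
noncomputable def blochVec (P : Op) : Fin 3 → ℝ :=
  ![2 * (P 0 1).re, -2 * (P 0 1).im, (P 0 0).re - (P 1 1).re]

/-- The off-diagonal entry of P² = P reads P₀₁ (tr P - 1) = 0: either the trace is 1, or P is
diagonal with entries 0 or 1 and must be 0 or the identity. -/
theorem trace_blochVec_of_projection {P : Op} (h : P.IsHermitian) (h2 : P * P = P) :
    ((P.trace.re = 0 ∨ P.trace.re = 2) ∧ blochVec P = 0) ∨
      (P.trace.re = 1 ∧ blochVec P 0 ^ 2 + blochVec P 1 ^ 2 + blochVec P 2 ^ 2 = 1) := by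
  have e : ∀ i j, star (P j i) = P i j := fun i j => h.apply i j
  have e00 := congrArg Complex.im (e 0 0)
  have e11 := congrArg Complex.im (e 1 1)
  have er := congrArg Complex.re (e 1 0)
  have ei := congrArg Complex.im (e 1 0)
  have f : ∀ i j, (P * P) i j = P i j := fun i j => by rw [h2]
  have f00 := congrArg Complex.re (f 0 0)
  have f11 := congrArg Complex.re (f 1 1)
  have fr := congrArg Complex.re (f 0 1)
  have fi := congrArg Complex.im (f 0 1)
  simp [Matrix.mul_apply, Fin.sum_univ_two] at e00 e11 er ei f00 f11 fr fi
  have i0 : (P 0 0).im = 0 := by linarith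
  have i1 : (P 1 1).im = 0 := by linarith
  rw [← er, ← ei] at f00 f11
  rw [i0] at f00 fr fi
  rw [i1] at f11 fr fi
  simp only [Matrix.trace, Matrix.diag, Fin.sum_univ_two, Complex.add_re, blochVec,
    Matrix.cons_val]
  generalize (P 0 0).re = p at *
  generalize (P 1 1).re = q at *
  generalize (P 0 1).re = x at *
  generalize (P 0 1).im = y at *
  by_cases hpq : p + q = 1
  · right
    refine ⟨hpq, ?_⟩
    have : q = 1 - p := by linarith
    subst this
    linear_combination 4 * f00
  · left
    have hx : x = 0 := by
      have : x * (p + q - 1) = 0 := by linear_combination fr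
      exact (mul_eq_zero.1 this).resolve_right fun h => hpq (by linarith)
    have hy : y = 0 := by
      have : y * (p + q - 1) = 0 := by linear_combination fi
      exact (mul_eq_zero.1 this).resolve_right fun h => hpq (by linarith)
    subst hx hy
    have hp : p = 0 ∨ p = 1 := by
      have : p * (p - 1) = 0 := by linear_combination f00
      exact (mul_eq_zero.1 this).imp_right fun h => by linarith
    have hq : q = 0 ∨ q = 1 := by
      have : q * (q - 1) = 0 := by linear_combination f11
      exact (mul_eq_zero.1 this).imp_right fun h => by linarith
    rcases hp with rfl | rfl <;> rcases hq with rfl | rfl <;> simp at hpq ⊢ <;> norm_num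

theorem traceA_mul_canonicalState {P : Op} (h : P.IsHermitian) (a t : Fin 3 → ℝ) (i j : Fin 2) :
    traceA ((P ⊗ₖ (1 : Op)) * canonicalState a t) i j
      = (1 / 4 : ℂ) * (((P.trace.re + ∑ l, a l * blochVec P l : ℝ) : ℂ) * (1 : Op) i j
        + ∑ l, ((t l * blochVec P l : ℝ) : ℂ) * pauli l.succ i j) := by
  have e10 : P 1 0 = star (P 0 1) := (h.apply 1 0).symm
  have e00 : ((P 0 0).re : ℂ) = P 0 0 := Complex.conj_eq_iff_re.1 (h.apply 0 0)
  have e11 : ((P 1 1).re : ℂ) = P 1 1 := Complex.conj_eq_iff_re.1 (h.apply 1 1)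
  obtain ⟨x, y, e01⟩ : ∃ x y : ℝ, P 0 1 = x + y * Complex.I :=
    ⟨_, _, (Complex.re_add_im (P 0 1)).symm⟩
  have e10' : P 1 0 = x - y * Complex.I := by
    rw [e10, e01]
    simp [sub_eq_add_neg]
  have hX : ∀ X : Op2, traceA ((P ⊗ₖ (1 : Op)) * X) i j = ∑ k, ∑ l, P k l * X (l, i) (k, j) :=
    fun X => by
      simp [traceA, Matrix.mul_apply, Fintype.sum_prod_type, Matrix.kroneckerMap_apply,
        Matrix.one_apply]
  rw [hX]
  simp only [Fin.sum_univ_two, canonicalState_eq, Fin.sum_univ_three, Matrix.trace, Matrix.diag,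
    Complex.add_re, blochVec, Matrix.cons_val, e10']
  rw [← e00, ← e11, e01]
  fin_cases i <;> fin_cases j <;> simp [pauli] <;> ring_nf <;> simp <;> ring

/-- A function that is odd on vectors sums to zero over the Bloch vectors of a projective
measurement. -/
theorem sum_odd_blochVec {n : ℕ} {P : Fin n → Op} (hP : IsProjectiveMeasurement P)
    {g : (Fin 3 → ℝ) → ℝ} (hg : ∀ v, g (-v) = -g v) : ∑ k, g (blochVec (P k)) = 0 := by
  have g0 : g 0 = 0 := by have := hg 0; rw [neg_zero] at this; linarith
  have hsum : ∑ k, blochVec (P k) = 0 := by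
    have e : ∀ i j, ∑ k, P k i j = (1 : Op) i j := fun i j => by
      rw [← hP.2, Matrix.sum_apply]
    have e01 := e 0 1
    have e00 := congrArg Complex.re (e 0 0)
    have e11 := congrArg Complex.re (e 1 1)
    have e01r := congrArg Complex.re e01
    have e01i := congrArg Complex.im e01
    simp only [Complex.re_sum, Complex.im_sum] at e00 e11 e01r e01i
    simp at e00 e11 e01r e01i
    ext l
    rw [Finset.sum_apply]
    fin_cases l <;> simp [blochVec, Finset.sum_sub_distrib, ← Finset.mul_sum, e00, e11, e01r, e01i]
  have htr : ∑ k, (P k).trace.re = 2 := by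
    rw [← Complex.re_sum, ← Matrix.trace_sum, hP.2]
    simp
  classical
  -- S collects the rank-one outcomes. Each has trace 1 and the total is 2, so there are at most
  -- two, and two of them have opposite Bloch vectors.
  set S := Finset.univ.filter fun k => blochVec (P k) ≠ 0 with hS
  have hS1 : ∀ k ∈ S, (P k).trace.re = 1 := fun k hk => by
    rcases trace_blochVec_of_projection (hP.1 k).1 (hP.1 k).2 with h | h
    · exact absurd h.2 (Finset.mem_filter.1 hk).2
    · exact h.1
  have hcard : S.card ≤ 2 := by
    have h1 : ∑ k ∈ S, (P k).trace.re ≤ ∑ k, (P k).trace.re := by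
      refine Finset.sum_le_sum_of_subset_of_nonneg (Finset.subset_univ _) fun k _ _ => ?_
      rcases trace_blochVec_of_projection (hP.1 k).1 (hP.1 k).2 with ⟨h | h, _⟩ | ⟨h, _⟩ <;>
        rw [h] <;> norm_num
    rw [Finset.sum_congr rfl hS1, htr] at h1
    simp at h1
    exact_mod_cast h1
  have hSv : ∑ k ∈ S, blochVec (P k) = 0 := by
    rw [hS, Finset.sum_filter_ne_zero, hsum]
  have hSg : ∑ k, g (blochVec (P k)) = ∑ k ∈ S, g (blochVec (P k)) := by
    refine (Finset.sum_subset (Finset.subset_univ S) fun k _ hk => ?_).symm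
    have : blochVec (P k) = 0 := by simpa [hS] using hk
    rw [this, g0]
  rw [hSg]
  interval_cases hc : S.card
  · rw [Finset.card_eq_zero.1 hc, Finset.sum_empty]
  · obtain ⟨k, hk⟩ := Finset.card_eq_one.1 hc
    rw [hk, Finset.sum_singleton] at hSv ⊢
    rw [hSv, g0]
  · obtain ⟨k, l, hkl, hk⟩ := Finset.card_eq_two.1 hc
    rw [hk, Finset.sum_pair hkl] at hSv ⊢
    rw [eq_neg_of_add_eq_zero_right hSv, hg, add_neg_cancel]

theorem blochOp_apply (x : Fin 3 → ℝ) (i j : Fin 2) :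
    blochOp x i j = (1 / 2 : ℂ) * ((1 : Op) i j + ∑ l, (x l : ℂ) * pauli l.succ i j) := by
  fin_cases i <;> fin_cases j <;> simp [blochOp, pauli, Fin.sum_univ_three] <;> ring

/-! ### The local hidden state model -/

/-- The direction, scaled by the visibility, onto which the dual of the extremal channel with
`sin² u = a` maps a measurement with Bloch vector `v`. -/
noncomputable def dualVec (a : ℝ) (v : Fin 3 → ℝ) : Space :=
  WithLp.toLp 2 ![√(1 - a) * v 0, √(1 - a) * v 1, (1 - a) * v 2]

theorem dualVec_neg (a : ℝ) (v : Fin 3 → ℝ) : dualVec a (-v) = -dualVec a v := by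
  ext i
  fin_cases i <;> simp [dualVec]

theorem norm_dualVec_le {a : ℝ} (ha0 : 0 ≤ a) (ha1 : a < 1) {v : Fin 3 → ℝ}
    (hv : v 0 ^ 2 + v 1 ^ 2 + v 2 ^ 2 = 1) : ‖dualVec a v‖ ≤ 1 - a * |v 2| := by
  have hz : |v 2| ≤ 1 :=
    (sq_le_one_iff_abs_le_one _).1 (by nlinarith [sq_nonneg (v 0), sq_nonneg (v 1)])
  have hs : √(1 - a) ^ 2 = 1 - a := Real.sq_sqrt (by linarith)
  refine abs_le_of_sq_le_sq' ?_ (by nlinarith) |>.2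
  rw [EuclideanSpace.real_norm_sq_eq, Fin.sum_univ_three]
  simp only [dualVec, Matrix.cons_val, mul_pow, hs]
  have hsq := sq_abs (v 2)
  -- The difference of the two squares is exactly a (1 - |v₂|)².
  nlinarith [mul_nonneg ha0 (sq_nonneg (1 - |v 2|))]

/-- The probability with which Alice announces the outcome `P` for the hidden variable `y`. -/
noncomputable def response (a : ℝ) (P : Op) (y : Space) : ℝ :=
  (P.trace.re + a * blochVec P 2) / 2
    + ‖dualVec a (blochVec P)‖ / 2 * Real.sign (inner ℝ y (dualVec a (blochVec P)))

theorem measurable_response (a : ℝ) (P : Op) : Measurable (response a P) :=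
  ((measurable_realSign.comp (by fun_prop)).const_mul _).const_add _

theorem response_nonneg {a : ℝ} (ha0 : 0 ≤ a) (ha1 : a < 1) {P : Op} (h : P.IsHermitian)
    (h2 : P * P = P) (y : Space) : 0 ≤ response a P y := by
  rw [response]
  rcases trace_blochVec_of_projection h h2 with ⟨hτ, hv⟩ | ⟨hτ, hv⟩
  · have : dualVec a 0 = 0 := by
      ext i
      fin_cases i <;> simp [dualVec]
    rw [hv, this]
    rcases hτ with hτ | hτ <;> simp [hτ]
  · have h1 := norm_dualVec_le ha0 ha1 hv
    have h3 := abs_le.1 (abs_realSign_le (inner ℝ y (dualVec a (blochVec P))))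
    rw [hτ]
    nlinarith [neg_abs_le (blochVec P 2), norm_nonneg (dualVec a (blochVec P))]

theorem sum_response {a : ℝ} {n : ℕ} {P : Fin n → Op} (hP : IsProjectiveMeasurement P)
    (y : Space) : ∑ k, response a (P k) y = 1 := by
  have htr : ∑ k, (P k).trace.re = 2 := by
    rw [← Complex.re_sum, ← Matrix.trace_sum, hP.2]
    simp
  have h := sum_odd_blochVec hP (g := fun v => a * v 2 / 2
    + ‖dualVec a v‖ / 2 * Real.sign (inner ℝ y (dualVec a v))) fun v => by
      rw [dualVec_neg, norm_neg, inner_neg_right, Real.sign_neg, Pi.neg_apply]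
      ring
  have h2 : ∀ k, response a (P k) y = (P k).trace.re / 2 + (a * blochVec (P k) 2 / 2
      + ‖dualVec a (blochVec (P k))‖ / 2 * Real.sign (inner ℝ y (dualVec a (blochVec (P k))))) :=
    fun k => by rw [response]; ring
  simp_rw [h2]
  rw [Finset.sum_add_distrib, h, ← Finset.sum_div, htr]
  norm_num

theorem integrableOn_response_mul (a : ℝ) (P : Op) {f : Space → ℝ} (hf : Continuous f) :
    IntegrableOn (fun y => response a P y * f y) (Metric.ball (0 : Space) 1) := by
  have := ((integrableOn_ball_of_continuous hf).const_mul
    ((P.trace.re + a * blochVec P 2) / 2)).add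
    ((integrableOn_ball_sign_mul (dualVec a (blochVec P)) hf).const_mul
      (‖dualVec a (blochVec P)‖ / 2))
  refine this.congr (.of_forall fun y => ?_)
  simp only [Pi.add_apply, response]
  ring

theorem integral_response_mul (a : ℝ) (P : Op) {f : Space → ℝ} (hf : Continuous f) :
    ∫ y in Metric.ball (0 : Space) 1, response a P y * f y
      = (P.trace.re + a * blochVec P 2) / 2 * (∫ y in Metric.ball (0 : Space) 1, f y)
        + ‖dualVec a (blochVec P)‖ / 2 * ∫ y in Metric.ball (0 : Space) 1,
            Real.sign (inner ℝ y (dualVec a (blochVec P))) * f y := by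
  rw [← integral_const_mul, ← integral_const_mul, ← integral_add
    ((integrableOn_ball_of_continuous hf).const_mul _)
    ((integrableOn_ball_sign_mul (dualVec a (blochVec P)) hf).const_mul _)]
  congr 1
  ext y
  rw [response]
  ring

/-- The sign part of the response is odd in y, so against an even function only the constant part
survives. -/
theorem integral_response_mul_even (a : ℝ) (P : Op) {f : Space → ℝ} (hf : Continuous f)
    (he : ∀ y, f (-y) = f y) :
    ∫ y in Metric.ball (0 : Space) 1, response a P y * f y
      = (P.trace.re + a * blochVec P 2) / 2 * ∫ y in Metric.ball (0 : Space) 1, f y := by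
  rw [integral_response_mul a P hf, integral_ball_odd (f := fun y => Real.sign _ * f y), mul_zero,
    add_zero]
  intro y
  rw [inner_neg_left, Real.sign_neg, he, neg_mul]

theorem integral_response_mul_coord (a : ℝ) (P : Op) (l : Fin 3) :
    ∫ y in Metric.ball (0 : Space) 1, response a P y * y l
      = Real.pi / 4 * dualVec a (blochVec P) l := by
  have h := integral_ball_sign_inner (dualVec a (blochVec P)) (EuclideanSpace.single l 1)
  simp only [EuclideanSpace.inner_single_right, one_mul, conj_trivial] at h
  rw [integral_response_mul a P (by fun_prop), integral_ball_odd (f := fun y => y l) (by simp)]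
  linarith

theorem nonSteerable_of_sphereMean_le {a p q : ℝ} (ha0 : 0 ≤ a) (ha1 : a < 1)
    (h : sphereMean p q ≤ 1) :
    NonSteerable (canonicalState ![0, 0, a] ![√(1 - a) * p, √(1 - a) * p, (1 - a) * q]) := by
  set t : Fin 3 → ℝ := ![p, p, q] with ht
  -- The first term is ‖T y‖. The second restores the total mass π/2 when the mean is below 1; |y₂|
  -- serves because it is even, nonnegative and has integral π/2. The hidden Bloch vectors T y / d y
  -- then merely become shorter.
  set d : Space → ℝ := fun y => √(p ^ 2 * (y 0 ^ 2 + y 1 ^ 2) + q ^ 2 * y 2 ^ 2)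
    + (1 - sphereMean p q) * |y 2| with hd
  have hdc : Continuous d := by fun_prop
  have hd0 : ∀ y, 0 ≤ d y := fun y =>
    add_nonneg (Real.sqrt_nonneg _) (mul_nonneg (by linarith) (abs_nonneg _))
  have hde : ∀ y, d (-y) = d y := fun y => by simp [hd]
  have hdi : ∫ y in Metric.ball (0 : Space) 1, d y = Real.pi / 2 := by
    rw [integral_add (integrableOn_ball_of_continuous (by fun_prop))
      (integrableOn_ball_of_continuous (by fun_prop)), integral_const_mul, integral_ball_sqrt,
      integral_ball_abs_coord]
    ring
  have hnorm : ∀ y : Space, (t 0 * y 0) ^ 2 + (t 1 * y 1) ^ 2 + (t 2 * y 2) ^ 2 ≤ d y ^ 2 :=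
    fun y => by
      have h1 : √(p ^ 2 * (y 0 ^ 2 + y 1 ^ 2) + q ^ 2 * y 2 ^ 2) ≤ d y :=
        le_add_of_nonneg_right (mul_nonneg (by linarith) (abs_nonneg _))
      refine le_trans (le_of_eq ?_) (pow_le_pow_left₀ (Real.sqrt_nonneg _) h1 2)
      rw [Real.sq_sqrt (by positivity)]
      simp only [ht, Matrix.cons_val]
      ring
  -- Where d vanishes so does T y. Division by zero gives the Bloch vector 0 there, which is still a
  -- state.
  have hcancel : ∀ (y : Space) (l : Fin 3), d y * (t l * y l / d y) = t l * y l := fun y l => by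
    rcases eq_or_ne (d y) 0 with h0 | h0
    · have h1 := hnorm y
      rw [h0] at h1
      have h2 : (t l * y l) ^ 2 = 0 := by
        fin_cases l <;> simp only [Fin.zero_eta, Fin.mk_one, Fin.reduceFinMk] <;>
          nlinarith [sq_nonneg (t 0 * y 0), sq_nonneg (t 1 * y 1), sq_nonneg (t 2 * y 2)]
      rw [h0, zero_mul, pow_eq_zero_iff two_ne_zero |>.1 h2]
    · field_simp
  set w : Space → NNReal := fun y => Real.toNNReal (2 / Real.pi * d y) with hw
  have hwd : ∀ y, (w y : ℝ) = 2 / Real.pi * d y := fun y =>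
    Real.coe_toNNReal _ (mul_nonneg (by positivity) (hd0 y))
  have hwm : Measurable w := by fun_prop
  refine ⟨Space, inferInstance,
    (volume.restrict (Metric.ball 0 1)).withDensity fun y => (w y : ENNReal),
    fun y => blochOp fun l => t l * y l / d y, ⟨?_⟩, fun i j => ?_, fun y => ?_, fun n P hP => ?_⟩
  · rw [withDensity_apply _ MeasurableSet.univ, Measure.restrict_univ]
    have : ∀ y, (w y : ENNReal) = ENNReal.ofReal (2 / Real.pi * d y) := fun y => rfl
    simp_rw [this]
    rw [← ofReal_integral_eq_lintegral_ofReal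
      (integrableOn_ball_of_continuous (by fun_prop))
      (.of_forall fun y => mul_nonneg (by positivity) (hd0 y)), integral_const_mul, hdi]
    rw [show 2 / Real.pi * (Real.pi / 2) = 1 by field_simp, ENNReal.ofReal_one]
  · simp only [blochOp_apply]
    have := hdc.measurable
    fun_prop
  · apply isState_blochOp
    rcases eq_or_ne (d y) 0 with h0 | h0
    · simp [h0]
    · rw [div_pow, div_pow, div_pow, ← add_div, ← add_div]
      exact div_le_one_of_le₀ (hnorm y) (sq_nonneg _)
  · refine ⟨fun k => response a (P k), fun k => measurable_response a (P k),
      fun k y => response_nonneg ha0 ha1 (hP.1 k).1 (hP.1 k).2 y, sum_response hP,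
      fun k i j => ?_⟩
    rw [traceA_mul_canonicalState (hP.1 k).1, integral_withDensity_eq_integral_smul hwm]
    -- The density cancels the denominator of the Bloch vector, leaving the even function d and the
    -- odd coordinates y l.
    have hpt : ∀ y, w y • ((response a (P k) y : ℂ) * blochOp (fun l => t l * y l / d y) i j)
        = ((response a (P k) y * d y : ℝ) : ℂ) * ((1 : Op) i j / Real.pi)
          + ∑ l, ((response a (P k) y * y l : ℝ) : ℂ) * (t l * pauli l.succ i j / Real.pi) :=
      fun y => by
        have hc : ∀ l, (d y : ℂ) * ((t l * y l / d y : ℝ) : ℂ) = (t l * y l : ℝ) := fun l => by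
          rw [← Complex.ofReal_mul, hcancel]
        rw [NNReal.smul_def, hwd, Complex.real_smul, blochOp_apply]
        simp only [Fin.sum_univ_three]
        have h0 := hc 0
        have h1 := hc 1
        have h2 := hc 2
        generalize ((t 0 * y 0 / d y : ℝ) : ℂ) = c0 at *
        generalize ((t 1 * y 1 / d y : ℝ) : ℂ) = c1 at *
        generalize ((t 2 * y 2 / d y : ℝ) : ℂ) = c2 at *
        push_cast at h0 h1 h2 ⊢
        linear_combination (response a (P k) y : ℂ) / Real.pi * (h0 * pauli 1 i j
          + h1 * pauli 2 i j + h2 * pauli 3 i j)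
    simp_rw [hpt]
    rw [integral_add, integral_finsetSum]
    · simp_rw [integral_mul_const]
      simp only [integral_complex_ofReal]
      rw [integral_response_mul_even a (P k) hdc hde, hdi]
      simp_rw [integral_response_mul_coord]
      have hπ : (Real.pi : ℂ) ≠ 0 := Complex.ofReal_ne_zero.2 Real.pi_ne_zero
      simp only [Fin.sum_univ_three, dualVec, ht, Matrix.cons_val]
      push_cast
      field_simp
      ring
    · exact fun l _ => ((integrableOn_response_mul a (P k) (by fun_prop)).ofReal).mul_const _
    · exact ((integrableOn_response_mul a (P k) hdc).ofReal).mul_const _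
    · exact integrable_finsetSum _ fun l _ =>
        ((integrableOn_response_mul a (P k) (by fun_prop)).ofReal).mul_const _

/-! ### The surface and the states inside it -/

theorem sphereMean_congr {p q p' q' : ℝ} (hp : p ^ 2 = p' ^ 2) (hq : q ^ 2 = q' ^ 2) :
    sphereMean p q = sphereMean p' q' := by
  rw [sphereMean, sphereMean, hp, hq]

/-- Stating the preimage through squares covers both signs of cos u. The missing factor 2 comes from
cos² β = 1/2. -/
theorem sphereMean_of_preimage {a α β r p q : ℝ} (ha : a < 1) (hα : α ∈ Set.Icc 0 Real.pi)
    (hβ : Real.cos β = Real.sin β) (hr : 0 ≤ r)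
    (hp : (1 - a) * p ^ 2 = (r * Real.sin α * Real.cos β) ^ 2)
    (hq : (1 - a) ^ 2 * q ^ 2 = (r * Real.cos α) ^ 2) :
    sphereMean p q = r / surfaceRadius a α := by
  have ha' : 0 < 1 - a := by linarith
  have hc : Real.cos β ^ 2 = 1 / 2 := by
    have := Real.sin_sq_add_cos_sq β
    rw [← hβ] at this
    linarith
  rw [← sphereMean_preimage ha hα hr]
  apply sphereMean_congr
  · rw [div_pow, Real.sq_sqrt (by linarith), eq_div_iff (by linarith)]
    linear_combination 2 * hp + 2 * (r * Real.sin α) ^ 2 * hc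
  · rw [div_pow, eq_div_iff (by positivity)]
    linear_combination hq

theorem surfaceRadius_eq_iff {a α β r : ℝ} (ha0 : 0 ≤ a) (ha1 : a < 1)
    (hα : α ∈ Set.Icc 0 Real.pi) (hβ : Real.cos β = Real.sin β) (hr : 0 ≤ r) :
    r = surfaceRadius a α ↔
      ∃ u ∈ Set.Ico 0 Real.pi, ∃ t : Fin 3 → ℝ, IsBorderT t ∧
        applyAlice (pauliMap (extremalMatrix u u)) (canonicalState 0 t)
          = canonicalState ![0, 0, a] (sph r α β) := by
  have ha' : 0 < 1 - a := by linarith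
  have hR := surfaceRadius_pos ha1 hα
  have hs : √(1 - a) ^ 2 = 1 - a := Real.sq_sqrt ha'.le
  have hs0 : √(1 - a) ≠ 0 := (Real.sqrt_pos.2 ha').ne'
  constructor
  · intro h
    have hsa : √a ≤ 1 := Real.sqrt_le_one.2 ha1.le
    have hsin : Real.sin (Real.arcsin √a) = √a :=
      Real.sin_arcsin (by linarith [Real.sqrt_nonneg a]) hsa
    have hcos : Real.cos (Real.arcsin √a) = √(1 - a) := by
      rw [Real.cos_arcsin, Real.sq_sqrt ha0]
    refine ⟨Real.arcsin √a, ⟨Real.arcsin_nonneg.2 (Real.sqrt_nonneg a),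
      (Real.arcsin_le_pi_div_two _).trans_lt (by linarith [Real.pi_pos])⟩,
      ![r * Real.sin α * Real.cos β / √(1 - a), r * Real.sin α * Real.cos β / √(1 - a),
        r * Real.cos α / (1 - a)], ?_, ?_⟩
    · refine (isBorderT_iff (p := r * Real.sin α * Real.cos β / √(1 - a)) rfl rfl).2 ?_
      rw [sphereMean_of_preimage ha1 hα hβ hr, h, div_self hR.ne']
      · rw [div_pow, hs, mul_div_cancel₀ _ ha'.ne']
      · simp only [Matrix.cons_val]
        rw [div_pow, mul_div_cancel₀ _ (by positivity)]
    · rw [applyAlice_extremalMatrix, hsin, hcos, Real.mul_self_sqrt ha0,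
        Real.mul_self_sqrt ha'.le]
      congr 1
      simp only [sph, Matrix.cons_val, hβ]
      rw [mul_div_cancel₀ _ hs0, mul_div_cancel₀ _ ha'.ne']
  · rintro ⟨u, _, t, ht, h⟩
    rw [applyAlice_extremalMatrix] at h
    obtain ⟨hsin, ht'⟩ := canonicalState_inj h
    have e0 := congrFun ht' 0
    have e1 := congrFun ht' 1
    have e2 := congrFun ht' 2
    simp only [Matrix.cons_val, sph] at hsin e0 e1 e2
    have hcos : Real.cos u * Real.cos u = 1 - a := by
      linear_combination Real.sin_sq_add_cos_sq u - hsin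
    have h01 : t 1 ^ 2 = t 0 ^ 2 := by
      -- Since cos² u = 1 - a > 0, cos u can be cancelled even if negative, and t₀ = t₁ follows from
      -- cos β = sin β.
      have hc : Real.cos u ≠ 0 := fun hc => by
        rw [hc] at hcos
        linarith
      rw [mul_left_cancel₀ hc (e1.trans ((congrArg _ hβ.symm).trans e0.symm))]
    have h1 := (isBorderT_iff rfl h01).1 ht
    rw [sphereMean_of_preimage ha1 hα hβ hr (by rw [← e0, ← hcos]; ring)
      (by rw [← e2, ← hcos]; ring), div_eq_one_iff_eq hR.ne'] at h1
    exact h1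

theorem nonSteerable_of_le_surfaceRadius {a α β r : ℝ} (ha0 : 0 ≤ a) (ha1 : a < 1)
    (hα : α ∈ Set.Icc 0 Real.pi) (hβ : Real.cos β = Real.sin β) (hr : 0 ≤ r)
    (h : r ≤ surfaceRadius a α) : NonSteerable (canonicalState ![0, 0, a] (sph r α β)) := by
  have ha' : 0 < 1 - a := by linarith
  have hs : √(1 - a) ^ 2 = 1 - a := Real.sq_sqrt ha'.le
  have hs0 : √(1 - a) ≠ 0 := (Real.sqrt_pos.2 ha').ne'
  have h1 : sphereMean (r * Real.sin α * Real.cos β / √(1 - a)) (r * Real.cos α / (1 - a)) ≤ 1 := by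
    rw [sphereMean_of_preimage ha1 hα hβ hr]
    · exact div_le_one_of_le₀ h (hr.trans h)
    · rw [div_pow, hs, mul_div_cancel₀ _ ha'.ne']
    · rw [div_pow, mul_div_cancel₀ _ (by positivity)]
  have h2 := nonSteerable_of_sphereMean_le ha0 ha1 h1
  rw [mul_div_cancel₀ _ hs0, mul_div_cancel₀ _ ha'.ne'] at h2
  rw [sph, ← hβ]
  exact h2

/-! ### The example at a = 1/10 -/

theorem sph_arccos_example :
    sph (4 / 5) (Real.arccos (-(3 / 7))) (5 * Real.pi / 4)
      = ![-(8 * √5 / 35), -(8 * √5 / 35), -(12 / 35)] := by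
  have hsin : Real.sin (Real.arccos (-(3 / 7))) = 2 * (√5 * √2) / 7 := by
    rw [Real.sin_arccos, Real.sqrt_eq_iff_mul_self_eq (by norm_num) (by positivity)]
    have h2 : √2 ^ 2 = 2 := Real.sq_sqrt (by norm_num)
    have h5 : √5 ^ 2 = 5 := Real.sq_sqrt (by norm_num)
    linear_combination (-4 / 49) * (√2 ^ 2) * h5 - 20 / 49 * h2
  have hang : 5 * Real.pi / 4 = Real.pi / 4 + Real.pi := by ring
  have h2 : √2 * √2 = 2 := Real.mul_self_sqrt (by norm_num)
  rw [sph, hang, Real.cos_add_pi, Real.sin_add_pi, Real.cos_pi_div_four, Real.sin_pi_div_four,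
    Real.cos_arccos (by norm_num) (by norm_num), hsin]
  congr 1
  · linear_combination (-4 / 35) * √5 * h2
  congr 1
  · linear_combination (-4 / 35) * √5 * h2
  congr 1
  norm_num

/-- The cosine -3/7 gives cot² α = 9/40, hence c = -1/2, where the arcsine is π/4. The mean is then
(8 + 4π)/21, which is below 1 because π < 13/4. -/
theorem le_surfaceRadius_example :
    4 / 5 ≤ surfaceRadius (1 / 10) (Real.arccos (-(3 / 7))) := by
  have hα : Real.arccos (-(3 / 7)) ∈ Set.Icc 0 Real.pi :=
    ⟨Real.arccos_nonneg _, Real.arccos_le_pi _⟩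
  have hm := sphereMean_preimage (a := 1 / 10) (r := 4 / 5) (by norm_num) hα (by norm_num)
  have hR := surfaceRadius_pos (a := 1 / 10) (by norm_num) hα
  suffices h : 4 / 5 / surfaceRadius (1 / 10) (Real.arccos (-(3 / 7))) ≤ 1 from (div_le_one hR).1 h
  have hp : (4 / 5 * Real.sin (Real.arccos (-(3 / 7))) / √(2 * (1 - 1 / 10))) ^ 2
      = (8 * √2 / 21) ^ 2 := by
    rw [div_pow, mul_pow, Real.sin_arccos, Real.sq_sqrt (by norm_num), Real.sq_sqrt (by norm_num),
      div_pow (8 * √2), mul_pow, Real.sq_sqrt (by norm_num)]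
    norm_num
  have hq : (4 / 5 * Real.cos (Real.arccos (-(3 / 7))) / (1 - 1 / 10)) ^ 2 = (8 / 21) ^ 2 := by
    rw [Real.cos_arccos (by norm_num) (by norm_num)]
    norm_num
  rw [← hm, sphereMean_congr hp hq, sphereMean_eq_bracket (by positivity),
    abs_of_nonneg (by positivity)]
  have h2 : √2 * √2 = 2 := Real.mul_self_sqrt (by norm_num)
  have hc : (8 / 21 : ℝ) ^ 2 / (8 * √2 / 21) ^ 2 - 1 = -(1 / 2) := by
    rw [div_pow, div_pow, mul_pow, Real.sq_sqrt (by norm_num)]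
    norm_num
  have hhalf : √(1 / 2 : ℝ) = √2 / 2 := by
    rw [Real.sqrt_eq_iff_mul_self_eq (by norm_num) (by positivity)]
    linarith
  have harc : Real.arcsin (√2 / 2) = Real.pi / 4 := by
    rw [← Real.sin_pi_div_four, Real.arcsin_sin] <;> linarith [Real.pi_pos]
  rw [hc, bracket, if_pos (by norm_num), neg_neg, hhalf, harc,
    show (1 + -(1 / 2) : ℝ) = 1 / 2 by norm_num, hhalf]
  have h0 : √2 ≠ 0 := by positivity
  have : 8 * √2 / 21 * (√2 / 2 + 1 / (√2 / 2) * (Real.pi / 4)) = 8 / 21 + 4 / 21 * Real.pi := by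
    field_simp
    linear_combination 32 * h2
  rw [this]
  linarith [Real.pi_lt_d2]

theorem exists_entangled_not_bowles :
    ∃ α ∈ Set.Icc (Real.pi / 2) Real.pi, ∃ r : ℝ, 0 ≤ r ∧ r ≤ surfaceRadius (1 / 10) α ∧
      IsState (canonicalState ![0, 0, 1 / 10] (sph r α (5 * Real.pi / 4))) ∧
      ¬ IsSeparable (canonicalState ![0, 0, 1 / 10] (sph r α (5 * Real.pi / 4))) ∧
      ¬ BowlesCriterion ![0, 0, 1 / 10] (sph r α (5 * Real.pi / 4)) := by
  have h5 : (11 / 5 : ℝ) < √5 := Real.lt_sqrt_of_sq_lt (by norm_num)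
  have h5' : √5 < 9 / 4 := (Real.sqrt_lt' (by norm_num)).2 (by norm_num)
  refine ⟨Real.arccos (-(3 / 7)), ⟨?_, Real.arccos_le_pi _⟩, 4 / 5, by norm_num,
    le_surfaceRadius_example, ?_⟩
  · rw [Real.arccos_neg]
    linarith [Real.arccos_le_pi_div_two.2 (show (0 : ℝ) ≤ 3 / 7 by norm_num)]
  rw [sph_arccos_example]
  refine ⟨isState_canonicalState ?_ ?_ ?_, fun h => ?_, fun h => ?_⟩
  · rw [abs_of_pos] <;> norm_num
  · rw [abs_of_neg (by linarith), abs_of_pos (by norm_num)]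
    linarith
  · linarith
  -- The swap expectation is (1 + t₀ + t₁ + t₂)/2, negative here.
  · have := swap_trace_nonneg_of_isSeparable h
    simp [canonicalState_eq, pauli, Fin.sum_univ_succ] at this
    linarith
  -- In the direction x = e₁, orthogonal to a, the criterion reads 16√5/35 ≤ 1, which fails since √5
  -- > 11/5.
  · have := h ![1, 0, 0] (by simp [Fin.sum_univ_succ])
    simp only [Fin.sum_univ_three, Matrix.cons_val] at this
    rw [show (-(8 * √5 / 35) * 1) ^ 2 + (-(8 * √5 / 35) * 0) ^ 2 + (-(12 / 35) * 0 : ℝ) ^ 2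
      = (8 * √5 / 35) ^ 2 by ring, Real.sqrt_sq (by positivity)] at this
    norm_num at this
    linarith

end Steering

theorem mainTheorem3 :
    (∀ a α β r : ℝ, 0 ≤ a → a < 1 → α ∈ Set.Icc 0 Real.pi →
      β ∈ Set.Icc 0 (2 * Real.pi) → Real.cos β = Real.sin β → 0 ≤ r →
      -- the surface consists of the images of border T-states under extremal maps with `u = v`
      (r = Steering.surfaceRadius a α ↔
        ∃ u ∈ Set.Ico 0 Real.pi, ∃ t : Fin 3 → ℝ, Steering.IsBorderT t ∧
          Steering.applyAlice (Steering.pauliMap (Steering.extremalMatrix u u))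
              (Steering.canonicalState 0 t)
            = Steering.canonicalState ![0, 0, a] (Steering.sph r α β)) ∧
      -- states on or inside the surface are non-steerable
      (r ≤ Steering.surfaceRadius a α →
        Steering.IsState (Steering.canonicalState ![0, 0, a] (Steering.sph r α β)) →
        Steering.NonSteerable (Steering.canonicalState ![0, 0, a] (Steering.sph r α β)))) ∧
    -- for `a = 1/10` they include entangled states that violate the criterion of Bowles et al.
    (∃ α ∈ Set.Icc (Real.pi / 2) Real.pi, ∃ r : ℝ, 0 ≤ r ∧
      r ≤ Steering.surfaceRadius (1 / 10) α ∧
      Steering.IsState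
        (Steering.canonicalState ![0, 0, 1 / 10] (Steering.sph r α (5 * Real.pi / 4))) ∧
      ¬ Steering.IsSeparable
        (Steering.canonicalState ![0, 0, 1 / 10] (Steering.sph r α (5 * Real.pi / 4))) ∧
      ¬ Steering.BowlesCriterion ![0, 0, 1 / 10] (Steering.sph r α (5 * Real.pi / 4))) := by
  refine ⟨fun a α β r ha0 ha1 hα _ hβ hr => ⟨?_, fun h _ => ?_⟩, ?_⟩
  · exact Steering.surfaceRadius_eq_iff ha0 ha1 hα hβ hr
  · exact Steering.nonSteerable_of_le_surfaceRadius ha0 ha1 hα hβ hr h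
  · exact Steering.exists_entangled_not_bowles
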